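/- Let $Q$ be an integral ternary quadratic form on $\mathbb{Z}^3$ (that is, $Q(\mathbb{Z}^3)\subset\mathbb{Z}$), nondegenerate in the sense that its discriminant is nonzero, and let $\varepsilon>0$. Let $\mathrm{SO}_Q(\mathbb{Z})$ be the group of $\mathbb{Z}$-linear automorphisms of $\mathbb{Z}^3$ of determinant $1$ that preserve $Q$. Then there is a constant $C=C(Q,\varepsilon)>0$ such that the following holds for every nondegenerate integral binary quadratic form $q(x,y)=ax^2+bxy+cy^2$ (that is, $a,b,c\in\mathbb{Z}$ and $b^2-4ac\neq 0$). Let $f\geq 1$ be the integer such that $f^2$ is the greatest square dividing $\gcd(a,b,c)$. An embedding of $(\mathbb{Z}^2,q)$ into $(\mathbb{Z}^3,Q)$ is a $\mathbb{Z}$-linear map $\iota:\mathbb{Z}^2\to\mathbb{Z}^3$ with $Q(\iota(\mathbf{x}))=q(\mathbf{x})$ for all $\mathbf{x}\in\mathbb{Z}^2$ (such a map is automatically injective); $\mathrm{SO}_Q(\mathbb{Z})$ acts on these embeddings by $\gamma\cdot\iota=\gamma\circ\iota$. Then the number $N$ of $\mathrm{SO}_Q(\mathbb{Z})$-orbits of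 embeddings is finite and $$N\leq C\, f\,\max(|a|,|b|,|c|)^{\varepsilon}.$$ -/

import Mathlib

/-- The integral binary quadratic form `q(x, y) = a x² + b x y + c y²` on `ℤ²`. -/
def binaryForm (a b c : ℤ) : QuadraticForm ℤ (Fin 2 → ℤ) :=
  a • QuadraticMap.proj 0 0 + b • QuadraticMap.proj 0 1 + c • QuadraticMap.proj 1 1

theorem binaryForm_apply (a b c : ℤ) (v : Fin 2 → ℤ) :
    binaryForm a b c v = a * v 0 ^ 2 + b * (v 0 * v 1) + c * v 1 ^ 2 := by
  simp [binaryForm, pow_two]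

/-- An integral quadratic form is nondegenerate if its polar form
`(x, y) ↦ Q (x + y) - Q x - Q y` is nondegenerate (has trivial radical); on `ℤⁿ` this says
that the discriminant is nonzero. -/
def IsNondegenerate {n : ℕ} (Q : QuadraticForm ℤ (Fin n → ℤ)) : Prop :=
  LinearMap.BilinForm.Nondegenerate Q.polarBilin

/-- `SO_Q(ℤ)`: the ℤ-linear automorphisms of `ℤⁿ` of determinant one preserving `Q`. -/
def integralSO {n : ℕ} (Q : QuadraticForm ℤ (Fin n → ℤ)) :
    Subgroup ((Fin n → ℤ) ≃ₗ[ℤ] (Fin n → ℤ)) where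
  carrier := {g | LinearMap.det (g : (Fin n → ℤ) →ₗ[ℤ] (Fin n → ℤ)) = 1 ∧ ∀ v, Q (g v) = Q v}
  one_mem' := ⟨LinearMap.det_id, fun _ => rfl⟩
  mul_mem' := by
    rintro g h ⟨hg, hg'⟩ ⟨hh, hh'⟩
    refine ⟨?_, fun v => by rw [LinearEquiv.mul_apply, hg', hh']⟩
    have e : ((g * h : (Fin n → ℤ) ≃ₗ[ℤ] (Fin n → ℤ)) : (Fin n → ℤ) →ₗ[ℤ] (Fin n → ℤ))
        = (g : (Fin n → ℤ) →ₗ[ℤ] (Fin n → ℤ)) ∘ₗ h := rfl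
    rw [e, LinearMap.det_comp, hg, hh, one_mul]
  inv_mem' := by
    rintro g ⟨hg, hg'⟩
    refine ⟨?_, fun v => ?_⟩
    · have e := LinearEquiv.det_symm_mul_det g
      rwa [hg, mul_one] at e
    · rw [← hg' (g⁻¹ v)]
      exact congrArg Q (g.apply_symm_apply v)

/-- `SO_Q(ℤ)` acts on the embeddings `(ℤᵐ, q) ↪ (ℤⁿ, Q)` (the ℤ-linear maps `ι` with
`Q (ι x) = q x`) by `γ • ι = γ ∘ ι`. For nondegenerate `q` such maps are injective. -/
instance integralSOAction {m n : ℕ} (q : QuadraticForm ℤ (Fin m → ℤ)) (Q : QuadraticForm ℤ (Fin n → ℤ)) :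
    MulAction (integralSO Q) (q →qᵢ Q) where
  smul g ι :=
    { toLinearMap := (g.1 : (Fin n → ℤ) →ₗ[ℤ] (Fin n → ℤ)) ∘ₗ ι.toLinearMap
      map_app' := fun v => (g.2.2 (ι v)).trans (ι.map_app v) }
  one_smul _ := QuadraticMap.Isometry.ext fun _ => rfl
  mul_smul _ _ _ := QuadraticMap.Isometry.ext fun _ => rfl

/-- The quotient `SO_Q(ℤ) \ {embeddings (ℤᵐ, q) ↪ (ℤⁿ, Q)}`. -/
abbrev EmbeddingClasses {m n : ℕ} (q : QuadraticForm ℤ (Fin m → ℤ))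
    (Q : QuadraticForm ℤ (Fin n → ℤ)) : Type :=
  MulAction.orbitRel.Quotient (integralSO Q) (q →qᵢ Q)

/-!
The proof classifies embeddings `ι` of `q = a x² + b x y + c y²` by numerical invariants, in the
way Gauss attached roots of congruences to representations of a binary form by a ternary one, and
then counts the possible invariants.

*Invariants.* Some `U ∈ SL₃(ℤ)` brings `ι` to Hermite form: the two basis vectors go to `α e₀` and
`β e₀ + γ e₁` with `α, γ > 0` and `0 ≤ β < γ` (`exists_hermite_reduce`). In the new coordinates the
ternary form is `A x² + B x y + C y² + l x z + m y z + n z²`, where `A, B, C` are determined by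
`a, b, c, α, β, γ`. Shears fixing `e₀` and `e₁` change `(l, m)` by the lattice spanned by `(2A, B)`
and `(B, 2C)`, and the class of `(l, m)` is detected by the residues of `φ = 2Am - Bl` and
`ψ = 2Cl - Bm` modulo `B² - 4AC`; finally `n` is determined by the Gram determinant `Δ` of `Q`.
Hence `(α, γ, β, φ, ψ)` determines the `SO_Q(ℤ)`-orbit of `ι` (`exists_smul_eq_of_hasDatum`).

*Counting.* Let `D = b² - 4ac = (αγ)² (B² - 4AC)`.
* There are at most `d(|D|)²` pairs `(α, γ)`.
* For given `(α, γ)` there are at most `f d(γ)` values of `β` (`card_hermite_le`). This is the only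
  source of the factor `f`: two solutions differ by `γ s / t` in lowest terms, and for given `t`
  the admissible `s` form a residue class modulo `t / h` with `h²` dividing `a`, `b` and `c`.
* The residues satisfy `φ² ≡ -2AΔ`, `φψ ≡ BΔ`, `ψ² ≡ -2CΔ` modulo `B² - 4AC`. Every common divisor
  of `A, B, C` divides `Δ`, so some combination `χ = sφ + tψ` has a square that is nearly prime to
  the modulus. It takes few values (`card_sq_congr_le`) and nearly determines `φ` and `ψ`, which
  leaves `O_Q(d(|D|))` pairs (`card_pair_congr_le`).

So there are at most `32 Δ⁶ f d(|D|)⁴` orbits (`card_embeddingClasses_le`), and the divisor bound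
`d(n) = O(n ^ δ)` (`exists_card_divisors_le_rpow`) finishes the proof.
-/

/-! ### Counting solutions of congruences -/

open Finset in
/-- Integers below `m * h` lying in a single residue class modulo `m` number at most `h`. -/
theorem card_le_of_modEq {m h : ℕ} {S : Finset ℕ} (hS : S ⊆ range (m * h))
    (hmod : ∀ x ∈ S, ∀ y ∈ S, x ≡ y [MOD m]) : #S ≤ h := by
  have : #S ≤ #(range h) := by
    refine card_le_card_of_injOn (fun x => x / m) (fun x hx => ?_) fun x hx y hy hxy => ?_
    · have := mem_range.1 (hS hx)
      simpa using Nat.div_lt_of_lt_mul this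
    · have h1 : x % m = y % m := hmod x hx y hy
      have h2 : x / m = y / m := hxy
      rw [← Nat.div_add_mod x m, ← Nat.div_add_mod y m, h1, h2]
  simpa using this

theorem isCoprime_of_gcd_mul_left {g : ℕ} (hg : g ≠ 0) {s t : ℤ}
    (h : Int.gcd (g * s) (g * t) = g) : IsCoprime t s := by
  rw [Int.isCoprime_iff_gcd_eq_one, Int.gcd_comm]
  rw [Int.gcd_mul_left, Int.natAbs_natCast] at h
  exact Nat.eq_of_mul_eq_mul_left (Nat.pos_of_ne_zero hg) (h.trans (mul_one g).symm)

open Finset in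
/-- Given `α` and `γ`, the number of lattices containing `ℤ²` with Hermite parameters `(α, β, γ)` on
which the form `a x² + b x y + c y²` stays integral is at most `f` times the number of divisors
of `γ`. -/
theorem card_hermite_le {a b c : ℤ} {f : ℕ}
    (hf : ∀ k : ℕ, (k : ℤ) ^ 2 ∣ a → (k : ℤ) ^ 2 ∣ b → (k : ℤ) ^ 2 ∣ c → k ≤ f)
    (α γ : ℕ) (hα : α ≠ 0) (hγ : γ ≠ 0) (S : Finset ℕ) (hSr : S ⊆ range γ)
    (hS : ∀ β ∈ S, ∃ a' b' c' : ℤ, a = α ^ 2 * a' ∧ b = 2 * α * β * a' + α * γ * b' ∧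
      c = β ^ 2 * a' + β * γ * b' + γ ^ 2 * c') : #S ≤ f * #γ.divisors := by
  rcases S.eq_empty_or_nonempty with rfl | ⟨β₀, hβ₀⟩
  · simp
  obtain ⟨a', b₀, c₀, ha, hb, hc⟩ := hS β₀ hβ₀
  have hα' : (α : ℤ) ≠ 0 := by exact_mod_cast hα
  have hγ' : (γ : ℤ) ≠ 0 := by exact_mod_cast hγ
  have key : ∀ β ∈ S, (γ : ℤ) ^ 2 ∣ (β - β₀) * (a' * (β - β₀) - γ * b₀) := by
    intro β hβ
    obtain ⟨a₁, b₁, c₁, ha1, hb1, hc1⟩ := hS β hβ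
    obtain rfl : a₁ = a' := by
      have : (α : ℤ) ^ 2 * a₁ = α ^ 2 * a' := by rw [← ha1, ← ha]
      exact mul_left_cancel₀ (pow_ne_zero 2 hα') this
    have h1 : (γ : ℤ) * b₁ = γ * b₀ - 2 * a₁ * (β - β₀) := by
      apply mul_left_cancel₀ hα'
      linear_combination hb - hb1
    refine ⟨c₁ - c₀, ?_⟩
    linear_combination hc1 - hc + (β : ℤ) * h1
  refine card_le_mul_card_image_of_maps_to
    (f := fun β : ℕ => γ / Int.gcd (β - β₀) γ) (fun β _ => ?_) f fun t ht => ?_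
  · exact Nat.mem_divisors.2 ⟨Nat.div_dvd_of_dvd (by exact_mod_cast Int.gcd_dvd_right _ (γ : ℤ)), hγ⟩
  set T := S.filter (fun β : ℕ => γ / Int.gcd (β - β₀) γ = t) with hT
  rcases T.eq_empty_or_nonempty with h0 | ⟨β₁, hβ₁⟩
  · rw [h0]; simp
  have ht0 : t ≠ 0 := fun h => by simp [h] at ht
  have ht0' : (t : ℤ) ≠ 0 := by exact_mod_cast ht0
  obtain ⟨g, hg⟩ : t ∣ γ := Nat.dvd_of_mem_divisors ht
  have hg0 : g ≠ 0 := by rintro rfl; simp at hg; exact hγ hg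
  have hg0' : (g : ℤ) ≠ 0 := by exact_mod_cast hg0
  -- In lowest terms `(β - β₀) / γ = s / t`, and `t` divides `a'`.
  have key2 : ∀ β ∈ T, ∃ s : ℤ, (β : ℤ) - β₀ = s * g ∧ (t : ℤ) ∣ a' ∧
      (t : ℤ) ^ 2 ∣ a' * s - t * b₀ := by
    intro β hβ
    rw [hT, mem_filter] at hβ
    obtain ⟨hβS, hβt⟩ := hβ
    have hdg : Int.gcd ((β : ℤ) - β₀) γ = g := by
      have h1 : Int.gcd ((β : ℤ) - β₀) γ ∣ γ := by exact_mod_cast Int.gcd_dvd_right _ (γ : ℤ)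
      have h2 := Nat.div_mul_cancel h1
      rw [hβt] at h2
      exact Nat.eq_of_mul_eq_mul_left (Nat.pos_of_ne_zero ht0) (h2.trans hg)
    obtain ⟨s, hs⟩ : (g : ℤ) ∣ (β : ℤ) - β₀ := hdg ▸ Int.gcd_dvd_left _ (γ : ℤ)
    have hcop : IsCoprime (t : ℤ) s := by
      refine isCoprime_of_gcd_mul_left hg0 ?_
      rw [← hs]
      conv_rhs => rw [← hdg]
      rw [hg]; push_cast; rw [mul_comm]
    have hk := key β hβS
    rw [hs, hg] at hk
    have h5 : (t : ℤ) ^ 2 ∣ s * (a' * s - t * b₀) := by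
      refine (mul_dvd_mul_iff_left (pow_ne_zero 2 hg0')).1 ?_
      push_cast at hk
      exact (dvd_of_eq (by ring)).trans (hk.trans (dvd_of_eq (by ring)))
    have h6 : (t : ℤ) ^ 2 ∣ a' * s - t * b₀ := (hcop.pow_left).dvd_of_dvd_mul_left h5
    refine ⟨s, by rw [hs, mul_comm], ?_, h6⟩
    have h7 : (t : ℤ) ∣ a' * s :=
      (dvd_sub_left (dvd_mul_right (t : ℤ) b₀)).1 ((dvd_pow_self _ two_ne_zero).trans h6)
    exact hcop.dvd_of_dvd_mul_right h7
  obtain ⟨s₁, -, ⟨a'', rfl⟩, h₁⟩ := key2 β₁ hβ₁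
  have key3 : ∀ s : ℤ, (t : ℤ) ^ 2 ∣ t * a'' * s - t * b₀ → (t : ℤ) ∣ a'' * s - b₀ := by
    intro s hs
    refine (mul_dvd_mul_iff_left ht0').1 ?_
    exact (dvd_of_eq (by ring)).trans (hs.trans (dvd_of_eq (by ring)))
  -- The admissible `s` form one class modulo `t / h`, and `h ^ 2` divides all coefficients.
  set h := Int.gcd a'' t with hh
  have hht : (h : ℤ) ∣ t := Int.gcd_dvd_right _ _
  have hha : (h : ℤ) ∣ a'' := Int.gcd_dvd_left _ _
  have hhb : (h : ℤ) ∣ b₀ :=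
    (dvd_sub_right (hha.mul_right s₁)).1 (hht.trans (key3 s₁ h₁))
  have hhγ : (h : ℤ) ∣ γ := hht.trans ⟨g, by rw [hg]; push_cast; ring⟩
  have e1 : (h : ℤ) ^ 2 ∣ t * a'' := by rw [pow_two]; exact mul_dvd_mul hht hha
  have e2 : (h : ℤ) ^ 2 ∣ γ * b₀ := by rw [pow_two]; exact mul_dvd_mul hhγ hhb
  have e3 : (h : ℤ) ^ 2 ∣ γ ^ 2 := pow_dvd_pow_of_dvd hhγ 2
  have hhf : h ≤ f := by
    apply hf h
    · rw [ha]; exact e1.mul_left _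
    · rw [hb]
      refine dvd_add (e1.mul_left _) ?_
      rw [mul_assoc]; exact e2.mul_left _
    · rw [hc]
      refine dvd_add (dvd_add (e1.mul_left _) ?_) (e3.mul_right _)
      rw [mul_assoc]; exact e2.mul_left _
  refine le_trans ?_ hhf
  obtain ⟨t', ht'⟩ : h ∣ t := by exact_mod_cast hht
  have hh0 : h ≠ 0 := by rintro h0; rw [h0] at ht'; simp at ht'; exact ht0 ht'
  have hh0' : (h : ℤ) ≠ 0 := by exact_mod_cast hh0
  refine card_le_of_modEq (m := g * t') (fun β hβ => ?_) fun x hx y hy => ?_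
  · have := hSr (mem_filter.1 hβ).1
    rwa [show g * t' * h = γ by rw [hg, ht']; ring]
  · obtain ⟨sx, hsx, -, hx2⟩ := key2 x hx
    obtain ⟨sy, hsy, -, hy2⟩ := key2 y hy
    have h8 : (t : ℤ) ∣ a'' * (sy - sx) := by
      have := dvd_sub (key3 sy hy2) (key3 sx hx2)
      exact (this).trans (dvd_of_eq (by ring))
    obtain ⟨u, hu⟩ := hha
    have hcop : IsCoprime (t' : ℤ) u := by
      refine isCoprime_of_gcd_mul_left hh0 ?_
      rw [← hu]
      conv_rhs => rw [hh, ht']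
      push_cast; rfl
    have h9 : (t' : ℤ) ∣ sy - sx := by
      refine hcop.dvd_of_dvd_mul_left ((mul_dvd_mul_iff_left hh0').1 ?_)
      refine (dvd_of_eq (by rw [ht']; push_cast; ring)).trans (h8.trans (dvd_of_eq ?_))
      rw [← mul_assoc, ← hu]
    rw [Nat.modEq_iff_dvd]
    have : (y : ℤ) - x = g * (sy - sx) := by linear_combination hsy - hsx
    rw [this]; push_cast
    exact mul_dvd_mul_left _ h9

open Finset in
/-- The congruence `x ^ 2 ≡ A` modulo `D` has few solutions when `4 * A` and `D` share only
small square factors. -/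
theorem card_sq_congr_le {D G : ℕ} {A : ℤ} (hD : D ≠ 0)
    (hG : ∀ e : ℕ, (e : ℤ) ^ 2 ∣ D → (e : ℤ) ^ 2 ∣ 4 * A → e ≤ G) (S : Finset ℕ)
    (hSr : S ⊆ range D) (hS : ∀ x ∈ S, (D : ℤ) ∣ x ^ 2 - A) : #S ≤ G * #D.divisors := by
  rcases S.eq_empty_or_nonempty with rfl | ⟨x₀, hx₀⟩
  · simp
  refine card_le_mul_card_image_of_maps_to
    (f := fun x : ℕ => Int.gcd (x - x₀) D) (fun β _ => ?_) G fun d hd => ?_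
  · exact Nat.mem_divisors.2 ⟨by exact_mod_cast Int.gcd_dvd_right _ (D : ℤ), hD⟩
  set T := S.filter (fun x : ℕ => Int.gcd (x - x₀) D = d) with hT
  rcases T.eq_empty_or_nonempty with h0 | ⟨x₁, hx₁⟩
  · rw [h0]; simp
  obtain ⟨d', hd'⟩ := Nat.dvd_of_mem_divisors hd
  have hd0 : d ≠ 0 := by rintro rfl; simp at hd' ; exact hD hd'
  -- With `d = gcd (x - x₀) D`, the cofactor `D / d` must divide `x + x₀`.
  have key : ∀ x ∈ T, (d : ℤ) ∣ x - x₀ ∧ (d' : ℤ) ∣ x + x₀ := by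
    intro x hx
    obtain ⟨hxS, hxd⟩ := mem_filter.1 hx
    obtain ⟨s, hs⟩ : (d : ℤ) ∣ (x : ℤ) - x₀ := hxd ▸ Int.gcd_dvd_left _ (D : ℤ)
    refine ⟨⟨s, hs⟩, ?_⟩
    have hcop : IsCoprime (d' : ℤ) s := by
      refine isCoprime_of_gcd_mul_left hd0 ?_
      rw [← hs]
      conv_rhs => rw [← hxd]
      rw [hd']; push_cast; rfl
    refine hcop.dvd_of_dvd_mul_left
      ((mul_dvd_mul_iff_left (by exact_mod_cast hd0 : (d : ℤ) ≠ 0)).1 ?_)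
    have h5 := dvd_sub (hS x hxS) (hS x₀ hx₀)
    rw [hd'] at h5
    refine (dvd_of_eq (by push_cast; ring)).trans (h5.trans (dvd_of_eq ?_))
    linear_combination ((x : ℤ) + x₀) * hs
  set e := Nat.gcd d d' with he
  have hed : (e : ℤ) ∣ d := by exact_mod_cast Nat.gcd_dvd_left d d'
  have hed' : (e : ℤ) ∣ d' := by exact_mod_cast Nat.gcd_dvd_right d d'
  have heD : (e : ℤ) ^ 2 ∣ D := by
    rw [hd', pow_two]; push_cast; exact mul_dvd_mul hed hed'
  have h2 : (e : ℤ) ∣ 2 * x₀ := by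
    have := dvd_sub (hed'.trans (key x₁ hx₁).2) (hed.trans (key x₁ hx₁).1)
    exact (this).trans (dvd_of_eq (by ring))
  refine le_trans ?_ (hG e heD ?_)
  · refine card_le_of_modEq (m := Nat.lcm d d') (fun β hβ => ?_) fun x hx y hy => ?_
    · have := hSr (mem_filter.1 hβ).1
      rwa [mul_comm, Nat.gcd_mul_lcm, ← hd']
    · rw [Nat.modEq_iff_dvd, Int.natCast_dvd]
      refine Nat.lcm_dvd ?_ ?_ <;> rw [← Int.natCast_dvd]
      · exact (dvd_sub (key y hy).1 (key x hx).1).trans (dvd_of_eq (by ring))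
      · exact (dvd_sub (key y hy).2 (key x hx).2).trans (dvd_of_eq (by ring))
  · have h3 := pow_dvd_pow_of_dvd h2 2
    have h4 := (heD.trans (hS x₀ hx₀)).mul_left 4
    exact (dvd_sub h3 h4).trans (dvd_of_eq (by ring))

/-- A primitive binary quadratic form represents an integer prime to any given one. -/
theorem exists_isCoprime_binary {a b c : ℤ} (hprim : ∀ p : ℕ, p.Prime → (p : ℤ) ∣ a →
    (p : ℤ) ∣ b → (p : ℤ) ∣ c → False) (n : ℕ) (hn : n ≠ 0) :
    ∃ s t : ℤ, IsCoprime (a * s ^ 2 + b * s * t + c * t ^ 2) n := by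
  induction n using Nat.recOnPosPrimePosCoprime with
  | zero => exact absurd rfl hn
  | one => exact ⟨0, 0, by simpa using isCoprime_one_right⟩
  | prime_pow p k hp hk =>
    have hpp : Prime (p : ℤ) := Nat.prime_iff_prime_int.1 hp
    have hc : ∀ x : ℤ, ¬ (p : ℤ) ∣ x → IsCoprime x ((p ^ k : ℕ) : ℤ) := by
      intro x hx
      push_cast
      exact ((hpp.coprime_iff_not_dvd.2 hx).symm).pow_right
    by_cases ha : (p : ℤ) ∣ a
    · by_cases hcc : (p : ℤ) ∣ c
      · refine ⟨1, 1, hc _ fun h => hprim p hp ha ?_ hcc⟩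
        have := dvd_sub (dvd_sub h ha) hcc
        exact (this).trans (dvd_of_eq (by ring))
      · exact ⟨0, 1, hc _ (by simpa using hcc)⟩
    · exact ⟨1, 0, hc _ (by simpa using ha)⟩
  | coprime m n hm hn' hmn ihm ihn =>
    obtain ⟨s, t, h1⟩ := ihm (by omega)
    obtain ⟨s', t', h2⟩ := ihn (by omega)
    obtain ⟨u, v, huv⟩ := (Nat.isCoprime_iff_coprime.2 hmn : IsCoprime (m : ℤ) n)
    refine ⟨s * (v * n) + s' * (u * m), t * (v * n) + t' * (u * m), ?_⟩
    push_cast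
    refine IsCoprime.mul_right ?_ ?_
    · have : ∃ z : ℤ, a * (s * (v * n) + s' * (u * m)) ^ 2 +
          b * (s * (v * n) + s' * (u * m)) * (t * (v * n) + t' * (u * m)) +
          c * (t * (v * n) + t' * (u * m)) ^ 2 = (a * s ^ 2 + b * s * t + c * t ^ 2) + m * z := by
        have hv : v * n = 1 - u * m := by linear_combination huv
        rw [hv]
        exact ⟨a * (2 * s * (u * (s' - s)) + m * (u * (s' - s)) ^ 2) +
          b * (s * (u * (t' - t)) + t * (u * (s' - s)) + m * (u * (s' - s)) * (u * (t' - t))) +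
          c * (2 * t * (u * (t' - t)) + m * (u * (t' - t)) ^ 2), by ring⟩
      obtain ⟨z, hz⟩ := this
      rw [hz]
      exact h1.add_mul_left_left z
    · have : ∃ z : ℤ, a * (s * (v * n) + s' * (u * m)) ^ 2 +
          b * (s * (v * n) + s' * (u * m)) * (t * (v * n) + t' * (u * m)) +
          c * (t * (v * n) + t' * (u * m)) ^ 2 =
          (a * s' ^ 2 + b * s' * t' + c * t' ^ 2) + n * z := by
        have hv : u * m = 1 - v * n := by linear_combination huv
        rw [hv]
        exact ⟨a * (2 * s' * (v * (s - s')) + n * (v * (s - s')) ^ 2) +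
          b * (s' * (v * (t - t')) + t' * (v * (s - s')) + n * (v * (s - s')) * (v * (t - t'))) +
          c * (2 * t' * (v * (t - t')) + n * (v * (t - t')) ^ 2), by ring⟩
      obtain ⟨z, hz⟩ := this
      rw [hz]
      exact h2.add_mul_left_left z

open Finset in
/-- The simultaneous congruences modulo `D` satisfied by the residues `(φ, ψ)` have `O(d(D))`
solutions, with a constant depending only on `Δ`. -/
theorem card_pair_congr_le {D : ℕ} {a b c Δ : ℤ} (hD : D ≠ 0) (hΔ : Δ ≠ 0)
    (hcont : ∀ g : ℤ, g ∣ a → g ∣ b → g ∣ c → g ∣ Δ) (S : Finset (ℕ × ℕ))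
    (hSr : S ⊆ range D ×ˢ range D)
    (hS : ∀ p ∈ S, (D : ℤ) ∣ p.1 ^ 2 + 2 * a * Δ ∧ (D : ℤ) ∣ p.1 * p.2 - b * Δ ∧
      (D : ℤ) ∣ p.2 ^ 2 + 2 * c * Δ) :
    #S ≤ 32 * Δ.natAbs ^ 6 * #D.divisors := by
  -- Write `(a, b, c) = g • (a₁, b₁, c₁)` with `(a₁, b₁, c₁)` primitive.
  set g : ℕ := Int.gcd a (Int.gcd b c) with hg
  have hga : (g : ℤ) ∣ a := Int.gcd_dvd_left _ _
  have hgbc : (g : ℤ) ∣ (Int.gcd b c : ℤ) := Int.gcd_dvd_right _ _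
  have hgb : (g : ℤ) ∣ b := hgbc.trans (Int.gcd_dvd_left _ _)
  have hgc : (g : ℤ) ∣ c := hgbc.trans (Int.gcd_dvd_right _ _)
  have hgΔ : (g : ℤ) ∣ Δ := hcont g hga hgb hgc
  have hg0 : (g : ℤ) ≠ 0 := fun h => hΔ (by simpa [h] using hgΔ)
  have hmax : ∀ k : ℤ, k ∣ a → k ∣ b → k ∣ c → k ∣ g := fun k h1 h2 h3 =>
    Int.dvd_coe_gcd h1 (Int.dvd_coe_gcd h2 h3)
  clear_value g
  obtain ⟨a₁, rfl⟩ := hga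
  obtain ⟨b₁, rfl⟩ := hgb
  obtain ⟨c₁, rfl⟩ := hgc
  obtain ⟨s, t, hst⟩ := exists_isCoprime_binary (a := a₁) (b := -b₁) (c := c₁)
    (fun p hp h1 h2 h3 => by
      have := hmax (g * p) (mul_dvd_mul_left _ h1) (mul_dvd_mul_left _ ((dvd_neg).1 h2))
        (mul_dvd_mul_left _ h3)
      have h4 : (p : ℤ) ∣ 1 := (mul_dvd_mul_iff_left hg0).1 (by simpa using this)
      exact (Nat.prime_iff_prime_int.1 hp).not_isUnit (isUnit_of_dvd_one h4)) D hD
  set r := a₁ * s ^ 2 + -b₁ * s * t + c₁ * t ^ 2 with hr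
  have hgΔ' : g ≤ Δ.natAbs :=
    Nat.le_of_dvd (Int.natAbs_pos.2 hΔ) (Int.natCast_dvd.1 hgΔ)
  have hD' : (D : ℤ) ≠ 0 := by exact_mod_cast hD
  have hchi : ∀ p ∈ S, (D : ℤ) ∣ (s * p.1 + t * p.2) ^ 2 + 2 * Δ * g * r := by
    intro p hp
    obtain ⟨h1, h2, h3⟩ := hS p hp
    have := dvd_add (dvd_add (h1.mul_left (s ^ 2)) (h2.mul_left (2 * s * t))) (h3.mul_left (t ^ 2))
    exact this.trans (dvd_of_eq (by rw [hr]; ring))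
  have hDpos : (0 : ℤ) < D := by positivity
  let F : ℕ × ℕ → ℕ := fun p => ((s * p.1 + t * p.2) % D).toNat
  have hF : ∀ p, (D : ℤ) ∣ F p - (s * p.1 + t * p.2) := by
    intro p
    have : ((F p : ℕ) : ℤ) = (s * p.1 + t * p.2) % D :=
      Int.toNat_of_nonneg (Int.emod_nonneg _ hD')
    rw [this]
    exact (Int.mod_modEq _ _).symm.dvd
  have himg : #(S.image F) ≤ (8 * Δ.natAbs ^ 2) * #D.divisors := by
    refine card_sq_congr_le (A := -(2 * Δ * g * r)) hD (fun e he1 he2 => ?_) _ ?_ ?_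
    · -- `r` is prime to `D`, so only `8 * Δ * g` can share a square factor with `D`.
      have h1 : (e : ℤ) ^ 2 ∣ 8 * Δ * g := by
        have hc : IsCoprime ((e : ℤ) ^ 2) r := (hst.of_isCoprime_of_dvd_right he1).symm
        refine hc.dvd_of_dvd_mul_right ?_
        rw [← dvd_neg]
        exact (he2).trans (dvd_of_eq (by ring))
      have h2 : e ^ 2 ∣ 8 * Δ.natAbs * g := by
        have := Int.natAbs_dvd_natAbs.2 h1
        simpa [Int.natAbs_mul, Int.natAbs_pow] using this
      have h3 : 0 < 8 * Δ.natAbs * g := by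
        have : 0 < Δ.natAbs := Int.natAbs_pos.2 hΔ
        have : 0 < g := Nat.pos_of_ne_zero (by exact_mod_cast hg0)
        positivity
      calc e ≤ e ^ 2 := Nat.le_self_pow two_ne_zero e
        _ ≤ 8 * Δ.natAbs * g := Nat.le_of_dvd h3 h2
        _ ≤ 8 * Δ.natAbs * Δ.natAbs := by gcongr
        _ = _ := by ring
    · intro x hx
      obtain ⟨p, -, rfl⟩ := mem_image.1 hx
      rw [mem_range]
      have := Int.emod_lt_of_pos (s * p.1 + t * p.2) hDpos
      have h2 := Int.emod_nonneg (s * p.1 + t * p.2) hD'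
      show ((s * p.1 + t * p.2) % (D : ℤ)).toNat < D
      omega
    · intro x hx
      obtain ⟨p, hp, rfl⟩ := mem_image.1 hx
      have h1 := hchi p hp
      have h2 := (hF p).mul_right (F p + (s * p.1 + t * p.2))
      exact (dvd_add h1 h2).trans (dvd_of_eq (by ring))
  -- Given `χ = s φ + t ψ`, the products `χ φ` and `χ ψ` are determined modulo `D`.
  have hfib : ∀ y ∈ S.image F, #{p ∈ S | F p = y} ≤ (2 * Δ.natAbs ^ 2) * (2 * Δ.natAbs ^ 2) := by
    intro y hy
    obtain ⟨p₀, hp₀, hp₀y⟩ := mem_image.1 hy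
    set h := Int.gcd y D with hh
    have hhD : (h : ℤ) ∣ D := Int.gcd_dvd_right _ _
    have hhy : (h : ℤ) ∣ y := Int.gcd_dvd_left _ _
    have hh0 : h ≠ 0 := fun h0 => hD' (by simpa [h0] using hhD)
    have hhle : h ≤ 2 * Δ.natAbs ^ 2 := by
      have h1 := hhD.trans (hchi p₀ hp₀)
      have h2 : (h : ℤ) ∣ s * p₀.1 + t * p₀.2 :=
        (dvd_sub_right hhy).1 (hp₀y ▸ hhD.trans (hF p₀))
      have h3 : (h : ℤ) ∣ 2 * Δ * g * r :=
        (dvd_add_right (h2.trans (dvd_pow_self _ two_ne_zero))).1 h1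
      have h4 : (h : ℤ) ∣ 2 * Δ * g :=
        ((hst.of_isCoprime_of_dvd_right hhD).symm).dvd_of_dvd_mul_right h3
      have h5 : h ∣ 2 * Δ.natAbs * g := by
        have := Int.natAbs_dvd_natAbs.2 h4
        simpa [Int.natAbs_mul, Int.natAbs_pow] using this
      have h6 : 0 < 2 * Δ.natAbs * g := by
        have : 0 < Δ.natAbs := Int.natAbs_pos.2 hΔ
        have : 0 < g := Nat.pos_of_ne_zero (by exact_mod_cast hg0)
        positivity
      calc h ≤ 2 * Δ.natAbs * g := Nat.le_of_dvd h6 h5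
        _ ≤ 2 * Δ.natAbs * Δ.natAbs := by gcongr
        _ = _ := by ring
    obtain ⟨D', hD'h⟩ : h ∣ D := by exact_mod_cast hhD
    obtain ⟨y', hy'⟩ := hhy
    have hcop : IsCoprime (D' : ℤ) y' := by
      refine isCoprime_of_gcd_mul_left hh0 ?_
      rw [← hy']
      conv_rhs => rw [hh, hD'h]
      push_cast; rfl
    have hcancel : ∀ u v : ℕ, (D : ℤ) ∣ y * (v - u) → u ≡ v [MOD D'] := by
      intro u v huv
      rw [Nat.modEq_iff_dvd]
      refine hcop.dvd_of_dvd_mul_left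
        ((mul_dvd_mul_iff_left (by exact_mod_cast hh0 : (h : ℤ) ≠ 0)).1 ?_)
      rw [hD'h, hy'] at huv
      exact (dvd_of_eq (by push_cast; ring)).trans (huv.trans (dvd_of_eq (by ring)))
    have hfix : ∀ p ∈ S, F p = y → (D : ℤ) ∣ y * p.1 - (t * (g * b₁ * Δ) - 2 * s * (g * a₁ * Δ)) ∧
        (D : ℤ) ∣ y * p.2 - (s * (g * b₁ * Δ) - 2 * t * (g * c₁ * Δ)) := by
      intro p hp hpy
      obtain ⟨h1, h2, h3⟩ := hS p hp
      have h4 := hF p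
      rw [hpy] at h4
      constructor
      · exact (dvd_add (dvd_add (h4.mul_right p.1) (h1.mul_left s)) (h2.mul_left t)).trans
          (dvd_of_eq (by ring))
      · exact (dvd_add (dvd_add (h4.mul_right p.2) (h3.mul_left t)) (h2.mul_left s)).trans
          (dvd_of_eq (by ring))
    set T := S.filter (fun p => F p = y) with hT
    have hsub : T ⊆ T.image Prod.fst ×ˢ T.image Prod.snd := fun p hp =>
      mem_product.2 ⟨mem_image_of_mem _ hp, mem_image_of_mem _ hp⟩
    refine (card_le_card hsub).trans ?_
    rw [card_product]
    refine Nat.mul_le_mul (le_trans ?_ hhle) (le_trans ?_ hhle)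
    · refine card_le_of_modEq (m := D') (fun x hx => ?_) fun u hu v hv => ?_
      · obtain ⟨p, hp, rfl⟩ := mem_image.1 hx
        have := (mem_product.1 (hSr (mem_filter.1 hp).1)).1
        rwa [mul_comm, ← hD'h]
      · obtain ⟨p, hp, rfl⟩ := mem_image.1 hu
        obtain ⟨p', hp', rfl⟩ := mem_image.1 hv
        have h1 := (hfix p (mem_filter.1 hp).1 (mem_filter.1 hp).2).1
        have h2 := (hfix p' (mem_filter.1 hp').1 (mem_filter.1 hp').2).1
        apply hcancel
        exact (dvd_sub h2 h1).trans (dvd_of_eq (by ring))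
    · refine card_le_of_modEq (m := D') (fun x hx => ?_) fun u hu v hv => ?_
      · obtain ⟨p, hp, rfl⟩ := mem_image.1 hx
        have := (mem_product.1 (hSr (mem_filter.1 hp).1)).2
        rwa [mul_comm, ← hD'h]
      · obtain ⟨p, hp, rfl⟩ := mem_image.1 hu
        obtain ⟨p', hp', rfl⟩ := mem_image.1 hv
        have h1 := (hfix p (mem_filter.1 hp).1 (mem_filter.1 hp).2).2
        have h2 := (hfix p' (mem_filter.1 hp').1 (mem_filter.1 hp').2).2
        apply hcancel
        exact (dvd_sub h2 h1).trans (dvd_of_eq (by ring))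
  calc #S ≤ _ := card_le_mul_card_image S _ hfib
    _ ≤ (2 * Δ.natAbs ^ 2) * (2 * Δ.natAbs ^ 2) * ((8 * Δ.natAbs ^ 2) * #D.divisors) :=
        Nat.mul_le_mul_left _ himg
    _ = _ := by ring

/-! ### The divisor bound -/

/-- The divisor bound: the number of divisors of `n` is `O(n ^ δ)` for every `δ > 0`. -/
theorem exists_card_divisors_le_rpow {δ : ℝ} (hδ : 0 < δ) :
    ∃ K : ℝ, 1 ≤ K ∧ ∀ n : ℕ, n ≠ 0 → (n.divisors.card : ℝ) ≤ K * (n : ℝ) ^ δ := by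
  -- In `∏ (e + 1) / p ^ (δ e)` the factors with `p ≥ 2 ^ (1 / δ)` are at most one and the others
  -- are bounded by a constant `κ`.
  obtain ⟨P, hP⟩ := exists_nat_ge ((2 : ℝ) ^ (1 / δ))
  set κ : ℝ := max 1 (1 / (δ * Real.log 2)) with hκ
  have hlog : 0 < Real.log 2 := Real.log_pos one_lt_two
  have hκ1 : 1 ≤ κ := le_max_left _ _
  have hκ2 : 1 ≤ κ * (δ * Real.log 2) := by
    have := le_max_right (1 : ℝ) (1 / (δ * Real.log 2))
    calc (1 : ℝ) = 1 / (δ * Real.log 2) * (δ * Real.log 2) := by field_simp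
      _ ≤ _ := by gcongr
  refine ⟨κ ^ P, one_le_pow₀ hκ1, fun n hn => ?_⟩
  have hloc : ∀ p ∈ n.primeFactors, ((n.factorization p + 1 : ℕ) : ℝ) ≤
      (if p < P then κ else 1) * ((p : ℝ) ^ n.factorization p) ^ δ := by
    intro p hp
    have hp2 : (2 : ℝ) ≤ p := by exact_mod_cast (Nat.prime_of_mem_primeFactors hp).two_le
    set e := n.factorization p
    have hcomm : ((p : ℝ) ^ e) ^ δ = ((p : ℝ) ^ δ) ^ e := by
      rw [← Real.rpow_natCast, ← Real.rpow_natCast, ← Real.rpow_mul (by positivity),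
        ← Real.rpow_mul (by positivity), mul_comm]
    rw [hcomm]
    split_ifs with h
    · have h1 : 1 + δ * Real.log 2 ≤ (p : ℝ) ^ δ := by
        calc 1 + δ * Real.log 2 ≤ Real.exp (δ * Real.log 2) := by
              rw [add_comm]; exact Real.add_one_le_exp _
          _ = (2 : ℝ) ^ δ := by rw [Real.rpow_def_of_pos two_pos, mul_comm]
          _ ≤ _ := Real.rpow_le_rpow (by norm_num) hp2 hδ.le
      have h2 : 1 + e * (δ * Real.log 2) ≤ ((p : ℝ) ^ δ) ^ e := by
        calc 1 + e * (δ * Real.log 2) ≤ (1 + δ * Real.log 2) ^ e :=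
              one_add_mul_le_pow (by nlinarith [mul_pos hδ hlog]) e
          _ ≤ _ := pow_le_pow_left₀ (by positivity) h1 e
      calc ((e + 1 : ℕ) : ℝ) = e * 1 + 1 := by push_cast; ring
        _ ≤ e * (κ * (δ * Real.log 2)) + κ := by gcongr
        _ = κ * (1 + e * (δ * Real.log 2)) := by ring
        _ ≤ _ := by gcongr
    · have h1 : (2 : ℝ) ≤ (p : ℝ) ^ δ := by
        have hPp : (P : ℝ) ≤ p := by exact_mod_cast not_lt.1 h
        calc (2 : ℝ) = ((2 : ℝ) ^ (1 / δ)) ^ δ := by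
              rw [← Real.rpow_mul (by norm_num), one_div_mul_cancel hδ.ne', Real.rpow_one]
          _ ≤ _ := Real.rpow_le_rpow (by positivity) (hP.trans hPp) hδ.le
      rw [one_mul]
      calc ((e + 1 : ℕ) : ℝ) ≤ ((2 ^ e : ℕ) : ℝ) := by exact_mod_cast Nat.lt_two_pow_self
        _ = (2 : ℝ) ^ e := by push_cast; rfl
        _ ≤ _ := pow_le_pow_left₀ (by norm_num) h1 e
  have hprod : (∏ p ∈ n.primeFactors, ((p : ℝ) ^ n.factorization p) ^ δ) = (n : ℝ) ^ δ := by
    rw [Real.finsetProd_rpow _ _ (fun p _ => by positivity)]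
    congr 1
    conv_rhs => rw [← Nat.prod_factorization_pow_eq_self hn]
    rw [Nat.prod_factorization_eq_prod_primeFactors]
    push_cast; rfl
  rw [Nat.card_divisors hn]
  push_cast
  calc (∏ p ∈ n.primeFactors, ((n.factorization p : ℝ) + 1))
      ≤ ∏ p ∈ n.primeFactors, (if p < P then κ else 1) * ((p : ℝ) ^ n.factorization p) ^ δ :=
        Finset.prod_le_prod (fun _ _ => by positivity) fun p hp => by exact_mod_cast hloc p hp
    _ = (∏ p ∈ n.primeFactors, if p < P then κ else 1) * (n : ℝ) ^ δ := by
        rw [Finset.prod_mul_distrib, hprod]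
    _ ≤ κ ^ P * (n : ℝ) ^ δ := by
        gcongr
        rw [← Finset.prod_filter, Finset.prod_const]
        refine pow_le_pow_right₀ hκ1 ?_
        calc (n.primeFactors.filter (· < P)).card ≤ (Finset.range P).card :=
              Finset.card_le_card fun p hp => by simpa using (Finset.mem_filter.1 hp).2
          _ = P := Finset.card_range P

/-! ### Counting the invariants of embeddings -/

/-- Numerical invariants `(((α, γ), β), (φ, ψ))` of an embedding of `a x² + b x y + c y²` in a
ternary form of Gram determinant `Δ`. The image of the embedding has saturation with form
`A x² + B x y + C y²`, in which it is spanned by `α e₀` and `β e₀ + γ e₁`; the residues `φ, ψ`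
modulo `B² - 4 A C` record how the saturation is completed to the whole lattice. -/
def IsEmbeddingDatum (a b c Δ : ℤ) (p : ((ℕ × ℕ) × ℕ) × (ℕ × ℕ)) : Prop :=
  ∃ A B C : ℤ, p.1.1.1 ≠ 0 ∧ p.1.2 < p.1.1.2 ∧
    a = p.1.1.1 ^ 2 * A ∧ b = 2 * p.1.1.1 * p.1.2 * A + p.1.1.1 * p.1.1.2 * B ∧
    c = p.1.2 ^ 2 * A + p.1.2 * p.1.1.2 * B + p.1.1.2 ^ 2 * C ∧
    (∀ g : ℤ, g ∣ A → g ∣ B → g ∣ C → g ∣ Δ) ∧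
    p.2.1 < (B ^ 2 - 4 * A * C).natAbs ∧ p.2.2 < (B ^ 2 - 4 * A * C).natAbs ∧
    B ^ 2 - 4 * A * C ∣ p.2.1 ^ 2 + 2 * A * Δ ∧
    B ^ 2 - 4 * A * C ∣ p.2.1 * p.2.2 - B * Δ ∧
    B ^ 2 - 4 * A * C ∣ p.2.2 ^ 2 + 2 * C * Δ

/-- Passing to the sublattice spanned by `α e₀` and `β e₀ + γ e₁`, of index `α γ`, multiplies the
discriminant by `(α γ) ^ 2`. -/
theorem discrim_hermite {a b c α β γ A B C : ℤ} (ha : a = α ^ 2 * A)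
    (hb : b = 2 * α * β * A + α * γ * B) (hc : c = β ^ 2 * A + β * γ * B + γ ^ 2 * C) :
    b ^ 2 - 4 * a * c = (α * γ) ^ 2 * (B ^ 2 - 4 * A * C) := by
  subst ha hb hc; ring

/-- The form on the saturation is determined by the Hermite parameters. -/
theorem coeff_unique {a b c α β γ A B C A' B' C' : ℤ} (hα : α ≠ 0) (hγ : γ ≠ 0)
    (ha : a = α ^ 2 * A) (hb : b = 2 * α * β * A + α * γ * B)
    (hc : c = β ^ 2 * A + β * γ * B + γ ^ 2 * C) (ha' : a = α ^ 2 * A')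
    (hb' : b = 2 * α * β * A' + α * γ * B')
    (hc' : c = β ^ 2 * A' + β * γ * B' + γ ^ 2 * C') : A = A' ∧ B = B' ∧ C = C' := by
  obtain rfl : A = A' := mul_left_cancel₀ (pow_ne_zero 2 hα) (ha.symm.trans ha')
  obtain rfl : B = B' :=
    mul_left_cancel₀ (mul_ne_zero hα hγ) (by linear_combination hb' - hb)
  exact ⟨rfl, rfl, mul_left_cancel₀ (pow_ne_zero 2 hγ) (by linear_combination hc' - hc)⟩

open Finset in
theorem card_embeddingDatum_le {a b c Δ : ℤ} (hD : b ^ 2 - 4 * a * c ≠ 0) (hΔ : Δ ≠ 0) {f : ℕ}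
    (hf : ∀ k : ℕ, (k : ℤ) ^ 2 ∣ a → (k : ℤ) ^ 2 ∣ b → (k : ℤ) ^ 2 ∣ c → k ≤ f)
    (S : Finset (((ℕ × ℕ) × ℕ) × (ℕ × ℕ))) (hS : ∀ p ∈ S, IsEmbeddingDatum a b c Δ p) :
    #S ≤ 32 * Δ.natAbs ^ 6 * f * #(b ^ 2 - 4 * a * c).natAbs.divisors ^ 4 := by
  set N := (b ^ 2 - 4 * a * c).natAbs with hN
  have hN0 : N ≠ 0 := Int.natAbs_ne_zero.2 hD
  have hdiv : ∀ d : ℕ, d ∣ N → #d.divisors ≤ #N.divisors := fun d hd =>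
    card_le_card (Nat.divisors_subset_of_dvd hN0 hd)
  have hNmul : ∀ {α β γ : ℕ} {A B C : ℤ}, a = α ^ 2 * A → b = 2 * α * β * A + α * γ * B →
      c = β ^ 2 * A + β * γ * B + γ ^ 2 * C →
      N = (α * γ) ^ 2 * (B ^ 2 - 4 * A * C).natAbs := by
    intro α β γ A B C h1 h2 h3
    rw [hN, discrim_hermite h1 h2 h3, Int.natAbs_mul, Int.natAbs_pow, Int.natAbs_mul]
    rfl
  have step1 : #S ≤ 32 * Δ.natAbs ^ 6 * #N.divisors * #(S.image Prod.fst) := by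
    refine card_le_mul_card_image S _ fun y hy => ?_
    obtain ⟨⟨α, γ⟩, β⟩ := y
    obtain ⟨p₀, hp₀, hp₀y⟩ := mem_image.1 hy
    obtain ⟨A, B, C, hα, hβ, ha, hb, hc, hg, -⟩ := hS p₀ hp₀
    rw [hp₀y] at hα hβ ha hb hc
    dsimp only at hα hβ ha hb hc
    have hN' := hNmul ha hb hc
    have hM0 : (B ^ 2 - 4 * A * C).natAbs ≠ 0 := fun h => hN0 (by rw [hN', h, mul_zero])
    set T := S.filter (fun p => p.1 = ((α, γ), β)) with hT
    have hcard : #T = #(T.image Prod.snd) := by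
      refine (card_image_of_injOn fun p hp q hq hpq => ?_).symm
      exact Prod.ext ((mem_filter.1 hp).2.trans (mem_filter.1 hq).2.symm) hpq
    have hall : ∀ r ∈ T.image Prod.snd, r.1 < (B ^ 2 - 4 * A * C).natAbs ∧
        r.2 < (B ^ 2 - 4 * A * C).natAbs ∧ B ^ 2 - 4 * A * C ∣ r.1 ^ 2 + 2 * A * Δ ∧
        B ^ 2 - 4 * A * C ∣ r.1 * r.2 - B * Δ ∧ B ^ 2 - 4 * A * C ∣ r.2 ^ 2 + 2 * C * Δ := by
      intro r hr
      obtain ⟨p, hp, rfl⟩ := mem_image.1 hr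
      obtain ⟨hpS, hpy⟩ := mem_filter.1 hp
      obtain ⟨A', B', C', -, -, ha', hb', hc', -, hrest⟩ := hS p hpS
      rw [hpy] at ha' hb' hc'
      obtain ⟨rfl, rfl, rfl⟩ := coeff_unique (by exact_mod_cast hα)
        (by exact_mod_cast (Nat.ne_zero_of_lt hβ)) ha hb hc ha' hb' hc'
      exact hrest
    rw [hcard]
    refine (card_pair_congr_le hM0 hΔ hg _ (fun r hr => ?_) fun r hr => ?_).trans
      (Nat.mul_le_mul_left _ (hdiv _ (hN' ▸ dvd_mul_left _ _)))
    · exact mem_product.2 ⟨mem_range.2 (hall r hr).1, mem_range.2 (hall r hr).2.1⟩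
    · simpa only [Int.natAbs_dvd] using (hall r hr).2.2
  have step2 : #(S.image Prod.fst) ≤
      f * #N.divisors * #((S.image Prod.fst).image Prod.fst) := by
    refine card_le_mul_card_image _ _ fun y hy => ?_
    obtain ⟨α, γ⟩ := y
    set T := (S.image Prod.fst).filter (fun p => p.1 = (α, γ)) with hT
    have hcard : #T = #(T.image Prod.snd) := by
      refine (card_image_of_injOn fun p hp q hq hpq => ?_).symm
      exact Prod.ext ((mem_filter.1 hp).2.trans (mem_filter.1 hq).2.symm) hpq
    have hall : ∀ β ∈ T.image Prod.snd, ∃ A B C : ℤ, α ≠ 0 ∧ β < γ ∧ a = α ^ 2 * A ∧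
        b = 2 * α * β * A + α * γ * B ∧ c = β ^ 2 * A + β * γ * B + γ ^ 2 * C := by
      intro β hβ
      obtain ⟨p, hp, rfl⟩ := mem_image.1 hβ
      obtain ⟨hpS, hpy⟩ := mem_filter.1 hp
      obtain ⟨s, hs, rfl⟩ := mem_image.1 hpS
      obtain ⟨A, B, C, h1, h2, h3, h4, h5, -⟩ := hS s hs
      rw [hpy] at h1 h2 h3 h4 h5
      exact ⟨A, B, C, h1, h2, h3, h4, h5⟩
    rw [hcard]
    rcases (T.image Prod.snd).eq_empty_or_nonempty with h0 | ⟨β₁, hβ₁⟩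
    · rw [h0]; simp
    obtain ⟨A, B, C, hα, hβ, ha, hb, hc⟩ := hall β₁ hβ₁
    have hγN : γ ∣ N :=
      (dvd_mul_left γ α).trans ((dvd_pow_self _ two_ne_zero).trans
        (hNmul ha hb hc ▸ dvd_mul_right _ _))
    refine (card_hermite_le hf α γ hα (Nat.ne_zero_of_lt hβ) _ (fun β hβ => ?_)
      fun β hβ => ?_).trans (Nat.mul_le_mul_left _ (hdiv _ hγN))
    · obtain ⟨-, -, -, -, h, -⟩ := hall β hβ
      exact mem_range.2 h
    · obtain ⟨A, B, C, -, -, h⟩ := hall β hβ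
      exact ⟨A, B, C, h⟩
  have step3 : #((S.image Prod.fst).image Prod.fst) ≤ #N.divisors * #N.divisors := by
    rw [← card_product]
    refine card_le_card fun y hy => ?_
    obtain ⟨p, hp, rfl⟩ := mem_image.1 hy
    obtain ⟨s, hs, rfl⟩ := mem_image.1 hp
    obtain ⟨A, B, C, h1, h2, h3, h4, h5, -⟩ := hS s hs
    have hN' := hNmul h3 h4 h5
    have h6 : s.1.1.1 * s.1.1.2 ∣ N := (dvd_pow_self _ two_ne_zero).trans (hN' ▸ dvd_mul_right _ _)
    exact mem_product.2 ⟨Nat.mem_divisors.2 ⟨(dvd_mul_right _ _).trans h6, hN0⟩,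
      Nat.mem_divisors.2 ⟨(dvd_mul_left _ _).trans h6, hN0⟩⟩
  calc #S ≤ _ := step1
    _ ≤ 32 * Δ.natAbs ^ 6 * #N.divisors * (f * #N.divisors * (#N.divisors * #N.divisors)) :=
        Nat.mul_le_mul_left _ (step2.trans (Nat.mul_le_mul_left _ step3))
    _ = _ := by ring

/-! ### Hermite form and Gram determinants -/

open Matrix

theorem exists_sl_two_reduce (x y : ℤ) :
    ∃ p q r s : ℤ, p * s - q * r = 1 ∧ 0 ≤ p * x + q * y ∧ r * x + s * y = 0 := by
  by_cases hg : Int.gcd x y = 0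
  · obtain ⟨rfl, rfl⟩ := Int.gcd_eq_zero_iff.1 hg
    exact ⟨1, 0, 0, 1, by simp⟩
  · have hg' : (Int.gcd x y : ℤ) ≠ 0 := by exact_mod_cast hg
    obtain ⟨u, hu⟩ : (Int.gcd x y : ℤ) ∣ x := Int.gcd_dvd_left _ _
    obtain ⟨v, hv⟩ : (Int.gcd x y : ℤ) ∣ y := Int.gcd_dvd_right _ _
    have hb := Int.gcd_eq_gcd_ab x y
    have hnn : 0 ≤ (Int.gcd x y : ℤ) := by positivity
    generalize (Int.gcd x y : ℤ) = g at *
    refine ⟨Int.gcdA x y, Int.gcdB x y, -v, u, mul_left_cancel₀ hg' ?_, ?_, ?_⟩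
    · linear_combination (-Int.gcdA x y) * hu - Int.gcdB x y * hv - hb
    · rwa [mul_comm _ x, mul_comm _ y, ← hb]
    · rw [hu, hv]; ring

/-- Row reduction of a pair of integral vectors to Hermite form by a matrix of determinant one. No
sign ambiguity is left, since a matrix in `SL₂(ℤ)` can take `(x, y)` to `(gcd x y, 0)`. -/
theorem exists_hermite_reduce (v w : Fin 3 → ℤ) :
    ∃ (U : SpecialLinearGroup (Fin 3) ℤ) (α γ : ℕ) (β : ℤ),
      U.1 *ᵥ v = ![(α : ℤ), 0, 0] ∧ U.1 *ᵥ w = ![β, (γ : ℤ), 0] ∧ (γ ≠ 0 → 0 ≤ β ∧ β < γ) := by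
  -- Clear `v 2`, then `v 1`, then `w 2`, and finally reduce `w 0` modulo `w 1`.
  obtain ⟨p, q, r, s, hdet, -, h0⟩ := exists_sl_two_reduce (v 1) (v 2)
  let U₁ : SpecialLinearGroup (Fin 3) ℤ := ⟨!![1, 0, 0; 0, p, q; 0, r, s], by
    rw [det_fin_three]; simp; linear_combination hdet⟩
  obtain ⟨p', q', r', s', hdet', hpos', h0'⟩ := exists_sl_two_reduce (v 0) (p * v 1 + q * v 2)
  let U₂ : SpecialLinearGroup (Fin 3) ℤ := ⟨!![p', q', 0; r', s', 0; 0, 0, 1], by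
    rw [det_fin_three]; simp; linear_combination hdet'⟩
  obtain ⟨α, hα⟩ := Int.eq_ofNat_of_zero_le hpos'
  have hv : U₂.1 *ᵥ (U₁.1 *ᵥ v) = ![(α : ℤ), 0, 0] := by
    ext i
    fin_cases i <;> simp [U₁, U₂, mulVec, dotProduct, Fin.sum_univ_three] <;> linarith
  set w' := U₂.1 *ᵥ (U₁.1 *ᵥ w) with hw'
  obtain ⟨p₃, q₃, r₃, s₃, hdet₃, hpos₃, h0₃⟩ := exists_sl_two_reduce (w' 1) (w' 2)
  let U₃ : SpecialLinearGroup (Fin 3) ℤ := ⟨!![1, 0, 0; 0, p₃, q₃; 0, r₃, s₃], by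
    rw [det_fin_three]; simp; linear_combination hdet₃⟩
  obtain ⟨γ, hγ⟩ := Int.eq_ofNat_of_zero_le hpos₃
  let U₄ : SpecialLinearGroup (Fin 3) ℤ := ⟨!![1, -(w' 0 / γ), 0; 0, 1, 0; 0, 0, 1], by
    rw [det_fin_three]; simp⟩
  refine ⟨U₄ * U₃ * U₂ * U₁, α, γ, w' 0 % γ, ?_, ?_, fun h => ⟨?_, ?_⟩⟩
  · change (U₄.1 * U₃.1 * U₂.1 * U₁.1) *ᵥ v = _
    simp only [← mulVec_mulVec]
    rw [hv]
    ext i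
    fin_cases i <;> simp [U₃, U₄, mulVec, dotProduct, Fin.sum_univ_three]
  · change (U₄.1 * U₃.1 * U₂.1 * U₁.1) *ᵥ w = _
    simp only [← mulVec_mulVec]
    rw [← hw']
    have h1 := Int.emod_def (w' 0) γ
    ext i
    fin_cases i <;> simp [U₃, U₄, mulVec, dotProduct, Fin.sum_univ_three]
    · rw [hγ, h1]; ring
    · exact hγ
    · exact h0₃
  · exact Int.emod_nonneg _ (by exact_mod_cast h)
  · exact Int.emod_lt_of_pos _ (by positivity)

namespace QuadraticMap

/-- The determinant of the Gram matrix of the polar form of an integral quadratic form. -/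
noncomputable def gramDet {n : ℕ} (Q : QuadraticForm ℤ (Fin n → ℤ)) : ℤ :=
  (LinearMap.BilinForm.toMatrix' Q.polarBilin).det

theorem gramDet_ne_zero {n : ℕ} {Q : QuadraticForm ℤ (Fin n → ℤ)} (h : IsNondegenerate Q) :
    gramDet Q ≠ 0 :=
  Matrix.nondegenerate_iff_det_ne_zero.1 (LinearMap.BilinForm.nondegenerate_toMatrix'_iff.2 h)

theorem gramDet_comp {n : ℕ} (Q : QuadraticForm ℤ (Fin n → ℤ))
    (U : SpecialLinearGroup (Fin n) ℤ) : gramDet (Q.comp (Matrix.toLin' U.1)) = gramDet Q := by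
  have h : (Q.comp (Matrix.toLin' U.1)).polarBilin =
      LinearMap.BilinForm.comp Q.polarBilin (Matrix.toLin' U.1) (Matrix.toLin' U.1) :=
    LinearMap.BilinForm.ext fun x y => by
      simp [polar, QuadraticMap.comp_apply, map_add]
  rw [gramDet, h, LinearMap.BilinForm.toMatrix'_comp, LinearMap.toMatrix'_toLin', det_mul, det_mul,
    det_transpose, U.2, one_mul, mul_one, gramDet]

theorem gramDet_binaryForm (a b c : ℤ) : gramDet (binaryForm a b c) = 4 * a * c - b ^ 2 := by
  rw [gramDet, det_fin_two]
  simp [LinearMap.BilinForm.toMatrix'_apply, polar, binaryForm_apply]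
  ring

theorem gramDet_ternary (Q : QuadraticForm ℤ (Fin 3 → ℤ)) {A B C l m n : ℤ}
    (hA : Q (Pi.single 0 1) = A) (hC : Q (Pi.single 1 1) = C) (hn : Q (Pi.single 2 1) = n)
    (hB : polar Q (Pi.single 0 1) (Pi.single 1 1) = B)
    (hl : polar Q (Pi.single 0 1) (Pi.single 2 1) = l)
    (hm : polar Q (Pi.single 1 1) (Pi.single 2 1) = m) :
    gramDet Q = 2 * (4 * A * C * n + B * l * m - A * m ^ 2 - C * l ^ 2 - n * B ^ 2) := by
  rw [gramDet, det_fin_three]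
  simp only [LinearMap.BilinForm.toMatrix'_apply, polarBilin_apply_apply, polar_self, hA, hB, hC,
    hl, hm, hn,
    polar_comm Q (Pi.single 1 1) (Pi.single 0 1), polar_comm Q (Pi.single 2 1) (Pi.single 0 1),
    polar_comm Q (Pi.single 2 1) (Pi.single 1 1), nsmul_eq_mul]
  push_cast
  ring

theorem apply_ternary (Q : QuadraticForm ℤ (Fin 3 → ℤ)) (v : Fin 3 → ℤ) :
    Q v = Q (Pi.single 0 1) * v 0 ^ 2 + Q (Pi.single 1 1) * v 1 ^ 2 + Q (Pi.single 2 1) * v 2 ^ 2 +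
      polar Q (Pi.single 0 1) (Pi.single 1 1) * (v 0 * v 1) +
      polar Q (Pi.single 0 1) (Pi.single 2 1) * (v 0 * v 2) +
      polar Q (Pi.single 1 1) (Pi.single 2 1) * (v 1 * v 2) := by
  have hv : v = v 0 • Pi.single 0 1 + v 1 • Pi.single 1 1 + v 2 • Pi.single 2 1 := by
    ext i; fin_cases i <;> simp
  conv_lhs => rw [hv]
  rw [QuadraticMap.map_add Q, QuadraticMap.map_add Q, polar_add_left]
  simp only [QuadraticMap.map_smul, polar_smul_left, polar_smul_right, smul_eq_mul]
  ring

end QuadraticMap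

/-! ### The invariants of an embedding -/

namespace QuadraticMap

/-- Two ternary forms of the same Gram determinant that restrict to the same form on `z = 0` and
have congruent residues `2Am - Bl` and `2Cl - Bm` differ by a shear fixing the plane `z = 0`. -/
theorem exists_shear_of_congr {P₁ P₂ : QuadraticForm ℤ (Fin 3 → ℤ)} {A B C l₁ m₁ l₂ m₂ : ℤ}
    (hA₁ : P₁ (Pi.single 0 1) = A) (hC₁ : P₁ (Pi.single 1 1) = C)
    (hB₁ : polar P₁ (Pi.single 0 1) (Pi.single 1 1) = B)
    (hl₁ : polar P₁ (Pi.single 0 1) (Pi.single 2 1) = l₁)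
    (hm₁ : polar P₁ (Pi.single 1 1) (Pi.single 2 1) = m₁)
    (hA₂ : P₂ (Pi.single 0 1) = A) (hC₂ : P₂ (Pi.single 1 1) = C)
    (hB₂ : polar P₂ (Pi.single 0 1) (Pi.single 1 1) = B)
    (hl₂ : polar P₂ (Pi.single 0 1) (Pi.single 2 1) = l₂)
    (hm₂ : polar P₂ (Pi.single 1 1) (Pi.single 2 1) = m₂)
    (hD : B ^ 2 - 4 * A * C ≠ 0) (hdet : gramDet P₁ = gramDet P₂)
    (hφ : B ^ 2 - 4 * A * C ∣ (2 * A * m₂ - B * l₂) - (2 * A * m₁ - B * l₁))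
    (hψ : B ^ 2 - 4 * A * C ∣ (2 * C * l₂ - B * m₂) - (2 * C * l₁ - B * m₁)) :
    ∃ T : SpecialLinearGroup (Fin 3) ℤ, (∀ i j : ℤ, T.1 *ᵥ ![i, j, 0] = ![i, j, 0]) ∧
      ∀ v, P₁ (T.1 *ᵥ v) = P₂ v := by
  -- Cramer's rule for `(l₂ - l₁, m₂ - m₁)` in terms of `(2A, B)` and `(B, 2C)`.
  obtain ⟨v, hv⟩ := hφ
  obtain ⟨u, hu⟩ := hψ
  have hl : l₂ = l₁ + 2 * A * -u + B * -v :=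
    mul_left_cancel₀ hD (by linear_combination -(2 * A) * hu - B * hv)
  have hm : m₂ = m₁ + B * -u + 2 * C * -v :=
    mul_left_cancel₀ hD (by linear_combination -B * hu - (2 * C) * hv)
  rw [gramDet_ternary P₁ hA₁ hC₁ rfl hB₁ hl₁ hm₁,
    gramDet_ternary P₂ hA₂ hC₂ rfl hB₂ hl₂ hm₂] at hdet
  have hn : P₂ (Pi.single 2 1) = P₁ (Pi.single 2 1) + A * u ^ 2 + B * u * v + C * v ^ 2
      - l₁ * u - m₁ * v := by
    apply mul_left_cancel₀ (mul_ne_zero two_ne_zero hD)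
    subst hl hm
    linear_combination hdet
  refine ⟨⟨!![1, 0, -u; 0, 1, -v; 0, 0, 1], by rw [det_fin_three]; simp⟩, fun i j => ?_,
    fun w => ?_⟩
  · ext k
    fin_cases k <;> simp [mulVec, dotProduct, Fin.sum_univ_three]
  · rw [apply_ternary P₁, apply_ternary P₂, hA₁, hC₁, hB₁, hl₁, hm₁, hA₂, hC₂, hB₂, hl₂, hm₂, hn,
      hl, hm]
    simp [mulVec, dotProduct, Fin.sum_univ_three]
    ring

end QuadraticMap

open QuadraticMap

/-- The form `Q` in the coordinates `U v`. -/
noncomputable def changeCoords (Q : QuadraticForm ℤ (Fin 3 → ℤ))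
    (U : SpecialLinearGroup (Fin 3) ℤ) : QuadraticForm ℤ (Fin 3 → ℤ) :=
  Q.comp (Matrix.toLin' (U⁻¹).1)

theorem inv_mulVec_mulVec (U : SpecialLinearGroup (Fin 3) ℤ) (v : Fin 3 → ℤ) :
    (U⁻¹).1 *ᵥ (U.1 *ᵥ v) = v := by
  rw [mulVec_mulVec]
  change ((U⁻¹ * U : SpecialLinearGroup (Fin 3) ℤ) : Matrix (Fin 3) (Fin 3) ℤ) *ᵥ v = v
  rw [inv_mul_cancel]; simp

theorem changeCoords_apply (Q : QuadraticForm ℤ (Fin 3 → ℤ)) (U : SpecialLinearGroup (Fin 3) ℤ)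
    (v : Fin 3 → ℤ) : changeCoords Q U v = Q ((U⁻¹).1 *ᵥ v) := rfl

theorem changeCoords_mulVec (Q : QuadraticForm ℤ (Fin 3 → ℤ)) (U : SpecialLinearGroup (Fin 3) ℤ)
    (v : Fin 3 → ℤ) : changeCoords Q U (U.1 *ᵥ v) = Q v := by
  rw [changeCoords_apply, inv_mulVec_mulVec]

theorem binaryForm_eq_hermite {a b c α β γ : ℤ} {Q : QuadraticForm ℤ (Fin 3 → ℤ)}
    (ι : binaryForm a b c →qᵢ Q) (U : SpecialLinearGroup (Fin 3) ℤ)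
    (h₀ : U.1 *ᵥ ι (Pi.single 0 1) = ![α, 0, 0]) (h₁ : U.1 *ᵥ ι (Pi.single 1 1) = ![β, γ, 0])
    {A B C : ℤ} (hA : changeCoords Q U (Pi.single 0 1) = A)
    (hC : changeCoords Q U (Pi.single 1 1) = C)
    (hB : polar (changeCoords Q U) (Pi.single 0 1) (Pi.single 1 1) = B) :
    a = α ^ 2 * A ∧ b = 2 * α * β * A + α * γ * B ∧ c = β ^ 2 * A + β * γ * B + γ ^ 2 * C := by
  have key : ∀ v, binaryForm a b c v = changeCoords Q U (U.1 *ᵥ ι v) := fun v => by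
    rw [changeCoords_mulVec, ι.map_app]
  have e0 := key (Pi.single 0 1)
  have e1 := key (Pi.single 1 1)
  have e2 := key (Pi.single 0 1 + Pi.single 1 1)
  rw [h₀, apply_ternary, hA, hC, hB, binaryForm_apply] at e0
  rw [h₁, apply_ternary, hA, hC, hB, binaryForm_apply] at e1
  rw [map_add ι, mulVec_add, h₀, h₁, apply_ternary, hA, hC, hB, binaryForm_apply] at e2
  simp at e0 e1 e2
  refine ⟨by linear_combination e0, by linear_combination e2 - e0 - e1, by linear_combination e1⟩

/-- `p` records the numerical invariants of `ι`, read off in the coordinates given by `U`. -/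
def HasDatum {a b c : ℤ} {Q : QuadraticForm ℤ (Fin 3 → ℤ)} (ι : binaryForm a b c →qᵢ Q)
    (U : SpecialLinearGroup (Fin 3) ℤ) (p : ((ℕ × ℕ) × ℕ) × (ℕ × ℕ)) : Prop :=
  U.1 *ᵥ ι (Pi.single 0 1) = ![(p.1.1.1 : ℤ), 0, 0] ∧
  U.1 *ᵥ ι (Pi.single 1 1) = ![(p.1.2 : ℤ), (p.1.1.2 : ℤ), 0] ∧
  ∃ A B C l m : ℤ, changeCoords Q U (Pi.single 0 1) = A ∧ changeCoords Q U (Pi.single 1 1) = C ∧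
    polar (changeCoords Q U) (Pi.single 0 1) (Pi.single 1 1) = B ∧
    polar (changeCoords Q U) (Pi.single 0 1) (Pi.single 2 1) = l ∧
    polar (changeCoords Q U) (Pi.single 1 1) (Pi.single 2 1) = m ∧
    B ^ 2 - 4 * A * C ∣ p.2.1 - (2 * A * m - B * l) ∧
    B ^ 2 - 4 * A * C ∣ p.2.2 - (2 * C * l - B * m)

theorem exists_hasDatum {a b c : ℤ} (hD : b ^ 2 - 4 * a * c ≠ 0)
    {Q : QuadraticForm ℤ (Fin 3 → ℤ)} (ι : binaryForm a b c →qᵢ Q) :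
    ∃ U p, HasDatum ι U p ∧ IsEmbeddingDatum a b c (gramDet Q) p := by
  obtain ⟨U, α, γ, β, h₀, h₁, hβ⟩ := exists_hermite_reduce (ι (Pi.single 0 1)) (ι (Pi.single 1 1))
  obtain ⟨A, hA⟩ : ∃ A, changeCoords Q U (Pi.single 0 1) = A := ⟨_, rfl⟩
  obtain ⟨C, hC⟩ : ∃ C, changeCoords Q U (Pi.single 1 1) = C := ⟨_, rfl⟩
  obtain ⟨n, hn⟩ : ∃ n, changeCoords Q U (Pi.single 2 1) = n := ⟨_, rfl⟩
  obtain ⟨B, hB⟩ : ∃ B, polar (changeCoords Q U) (Pi.single 0 1) (Pi.single 1 1) = B := ⟨_, rfl⟩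
  obtain ⟨l, hl⟩ : ∃ l, polar (changeCoords Q U) (Pi.single 0 1) (Pi.single 2 1) = l := ⟨_, rfl⟩
  obtain ⟨m, hm⟩ : ∃ m, polar (changeCoords Q U) (Pi.single 1 1) (Pi.single 2 1) = m := ⟨_, rfl⟩
  have hΔ : gramDet Q = 2 * (4 * A * C * n + B * l * m - A * m ^ 2 - C * l ^ 2 - n * B ^ 2) := by
    rw [← gramDet_ternary _ hA hC hn hB hl hm]
    exact (gramDet_comp Q U⁻¹).symm
  obtain ⟨ha, hb, hc⟩ := binaryForm_eq_hermite ι U h₀ h₁ hA hC hB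
  have hdis := discrim_hermite ha hb hc
  have hα : α ≠ 0 := by rintro rfl; exact hD (by rw [hdis]; simp)
  have hγ : γ ≠ 0 := by rintro rfl; exact hD (by rw [hdis]; simp)
  obtain ⟨hβ0, hβγ⟩ := hβ hγ
  obtain ⟨β, rfl⟩ := Int.eq_ofNat_of_zero_le hβ0
  set D' := B ^ 2 - 4 * A * C with hD'
  have hD'0 : D' ≠ 0 := by intro h; exact hD (by rw [hdis, h, mul_zero])
  have hres : ∀ x : ℤ, ∃ r : ℕ, r < D'.natAbs ∧ D' ∣ r - x := by
    intro x
    refine ⟨(x % D').toNat, ?_, ?_⟩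
    · have h1 := Int.emod_lt_abs x hD'0
      have h2 := Int.emod_nonneg x hD'0
      rw [Int.abs_eq_natAbs] at h1
      omega
    · rw [Int.toNat_of_nonneg (Int.emod_nonneg x hD'0)]
      exact (Int.mod_modEq x D').symm.dvd
  obtain ⟨φ, hφlt, hφ⟩ := hres (2 * A * m - B * l)
  obtain ⟨ψ, hψlt, hψ⟩ := hres (2 * C * l - B * m)
  refine ⟨U, (((α, γ), β), (φ, ψ)), ⟨h₀, h₁, A, B, C, l, m, hA, hC, hB, hl, hm, hφ, hψ⟩,
    A, B, C, hα, by exact_mod_cast hβγ, ha, hb, hc, fun g hgA hgB hgC => ?_, hφlt, hψlt, ?_, ?_, ?_⟩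
  · rw [hΔ]
    obtain ⟨A', rfl⟩ := hgA
    obtain ⟨B', rfl⟩ := hgB
    obtain ⟨C', rfl⟩ := hgC
    exact ⟨2 * (4 * A' * (g * C') * n + B' * l * m - A' * m ^ 2 - C' * l ^ 2 - n * B' * (g * B')),
      by ring⟩
  · obtain ⟨u, hu⟩ := hφ
    refine ⟨u * (φ + (2 * A * m - B * l)) + (l ^ 2 - 4 * A * n), ?_⟩
    dsimp only
    rw [hΔ]
    linear_combination (φ + (2 * A * m - B * l)) * hu + (l ^ 2 - 4 * A * n) * hD'
  · obtain ⟨u, hu⟩ := hφ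
    obtain ⟨v, hv⟩ := hψ
    refine ⟨u * ψ + v * (2 * A * m - B * l) + (2 * n * B - l * m), ?_⟩
    dsimp only
    rw [hΔ]
    linear_combination ψ * hu + (2 * A * m - B * l) * hv + (2 * n * B - l * m) * hD'
  · obtain ⟨v, hv⟩ := hψ
    refine ⟨v * (ψ + (2 * C * l - B * m)) + (m ^ 2 - 4 * C * n), ?_⟩
    dsimp only
    rw [hΔ]
    linear_combination (ψ + (2 * C * l - B * m)) * hv + (m ^ 2 - 4 * C * n) * hD'

/-- The invariants separate orbits: if `T` is the shear matching the two coordinate systems, then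
`U₁⁻¹ T U₂` preserves `Q` and takes `ι₂` to `ι₁`. -/
theorem exists_smul_eq_of_hasDatum {a b c : ℤ} (hD : b ^ 2 - 4 * a * c ≠ 0)
    {Q : QuadraticForm ℤ (Fin 3 → ℤ)} {ι₁ ι₂ : binaryForm a b c →qᵢ Q}
    {U₁ U₂ : SpecialLinearGroup (Fin 3) ℤ} {p : ((ℕ × ℕ) × ℕ) × (ℕ × ℕ)}
    (h₁ : HasDatum ι₁ U₁ p) (h₂ : HasDatum ι₂ U₂ p) : ∃ g : integralSO Q, g • ι₂ = ι₁ := by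
  obtain ⟨h10, h11, A, B, C, l₁, m₁, hA₁, hC₁, hB₁, hl₁, hm₁, hφ₁, hψ₁⟩ := h₁
  obtain ⟨h20, h21, A', B', C', l₂, m₂, hA₂, hC₂, hB₂, hl₂, hm₂, hφ₂, hψ₂⟩ := h₂
  obtain ⟨ha, hb, hc⟩ := binaryForm_eq_hermite ι₁ U₁ h10 h11 hA₁ hC₁ hB₁
  obtain ⟨ha', hb', hc'⟩ := binaryForm_eq_hermite ι₂ U₂ h20 h21 hA₂ hC₂ hB₂
  have hdis := discrim_hermite ha hb hc
  have hα : (p.1.1.1 : ℤ) ≠ 0 := fun h => hD (by rw [hdis, h]; simp)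
  have hγ : (p.1.1.2 : ℤ) ≠ 0 := fun h => hD (by rw [hdis, h]; simp)
  obtain ⟨rfl, rfl, rfl⟩ := coeff_unique hα hγ ha hb hc ha' hb' hc'
  obtain ⟨T, hT, hT'⟩ := exists_shear_of_congr hA₁ hC₁ hB₁ hl₁ hm₁ hA₂ hC₂ hB₂ hl₂ hm₂
    (fun h => hD (by rw [hdis, h, mul_zero]))
    ((gramDet_comp Q U₁⁻¹).trans (gramDet_comp Q U₂⁻¹).symm)
    ((dvd_sub hφ₁ hφ₂).trans (dvd_of_eq (by ring))) ((dvd_sub hψ₁ hψ₂).trans (dvd_of_eq (by ring)))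
  have happ : ∀ v, SpecialLinearGroup.toLin' (U₁⁻¹ * T * U₂) v =
      (U₁⁻¹).1 *ᵥ (T.1 *ᵥ (U₂.1 *ᵥ v)) := by
    intro v
    rw [SpecialLinearGroup.toLin'_apply, Matrix.toLin'_apply, mulVec_mulVec, mulVec_mulVec]
    rfl
  refine ⟨⟨SpecialLinearGroup.toLin' (U₁⁻¹ * T * U₂), ?_, fun v => ?_⟩, ?_⟩
  · rw [SpecialLinearGroup.toLin'_to_linearMap, LinearMap.det_toLin']
    exact (U₁⁻¹ * T * U₂).2
  · rw [happ, ← changeCoords_apply, hT', changeCoords_mulVec]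
  · refine QuadraticMap.Isometry.toLinearMap_injective ?_
    refine (Pi.basisFun ℤ (Fin 2)).ext fun i => ?_
    rw [Pi.basisFun_apply]
    change SpecialLinearGroup.toLin' (U₁⁻¹ * T * U₂) (ι₂ (Pi.single i 1)) = ι₁ (Pi.single i 1)
    rw [happ]
    fin_cases i
    · change (U₁⁻¹).1 *ᵥ (T.1 *ᵥ (U₂.1 *ᵥ ι₂ (Pi.single 0 1))) = ι₁ (Pi.single 0 1)
      rw [h20, hT, ← h10, inv_mulVec_mulVec]
    · change (U₁⁻¹).1 *ᵥ (T.1 *ᵥ (U₂.1 *ᵥ ι₂ (Pi.single 1 1))) = ι₁ (Pi.single 1 1)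
      rw [h21, hT, ← h11, inv_mulVec_mulVec]

/-! ### The number of orbits -/

open Finset in
theorem card_embeddingClasses_le {a b c : ℤ} (hD : b ^ 2 - 4 * a * c ≠ 0)
    {Q : QuadraticForm ℤ (Fin 3 → ℤ)} (hQ : gramDet Q ≠ 0) {f : ℕ}
    (hf : ∀ k : ℕ, (k : ℤ) ^ 2 ∣ a → (k : ℤ) ^ 2 ∣ b → (k : ℤ) ^ 2 ∣ c → k ≤ f) :
    Finite (EmbeddingClasses (binaryForm a b c) Q) ∧
      Nat.card (EmbeddingClasses (binaryForm a b c) Q) ≤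
        32 * (gramDet Q).natAbs ^ 6 * f * #(b ^ 2 - 4 * a * c).natAbs.divisors ^ 4 := by
  classical
  set X := EmbeddingClasses (binaryForm a b c) Q
  choose U p hp hp' using fun x : X => exists_hasDatum hD (Quotient.out x)
  have hinj : Function.Injective p := by
    intro x y hxy
    obtain ⟨g, hg⟩ := exists_smul_eq_of_hasDatum hD (hp x) (hxy ▸ hp y)
    rw [← Quotient.out_eq x, ← Quotient.out_eq y]
    exact Quotient.sound ⟨g, hg⟩
  have hbound : ∀ S : Finset X,
      #S ≤ 32 * (gramDet Q).natAbs ^ 6 * f * #(b ^ 2 - 4 * a * c).natAbs.divisors ^ 4 := by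
    intro S
    rw [← card_image_of_injective S hinj]
    refine card_embeddingDatum_le hD hQ hf _ fun q hq => ?_
    obtain ⟨x, -, rfl⟩ := mem_image.1 hq
    exact hp' x
  have hfin : Finite X := by
    by_contra h
    rw [not_finite_iff_infinite] at h
    obtain ⟨S, hS⟩ := Infinite.exists_subset_card_eq X
      (32 * (gramDet Q).natAbs ^ 6 * f * #(b ^ 2 - 4 * a * c).natAbs.divisors ^ 4 + 1)
    have := hbound S
    omega
  have := Fintype.ofFinite X
  exact ⟨hfin, by rw [Nat.card_eq_fintype_card]; exact hbound Finset.univ⟩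

theorem natAbs_discrim_le (a b c : ℤ) :
    ((b ^ 2 - 4 * a * c).natAbs : ℤ) ≤ 5 * (max |a| (max |b| |c|)) ^ 2 := by
  set M := max |a| (max |b| |c|)
  have ha : |a| ≤ M := le_max_left _ _
  have hb : |b| ≤ M := (le_max_left _ _).trans (le_max_right _ _)
  have hc : |c| ≤ M := (le_max_right _ _).trans (le_max_right _ _)
  have hM : 0 ≤ M := (abs_nonneg a).trans ha
  rw [← Int.abs_eq_natAbs]
  calc |b ^ 2 - 4 * a * c| ≤ |b ^ 2| + |4 * a * c| := abs_sub _ _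
    _ = |b| ^ 2 + 4 * (|a| * |c|) := by rw [abs_pow, abs_mul, abs_mul]; norm_num; ring
    _ ≤ M ^ 2 + 4 * (M * M) := by gcongr
    _ = 5 * M ^ 2 := by ring

theorem mainTheorem6 (Q : QuadraticForm ℤ (Fin 3 → ℤ)) (hQ : IsNondegenerate Q)
    (ε : ℝ) (hε : 0 < ε) :
    ∃ C : ℝ, 0 < C ∧ ∀ a b c : ℤ, IsNondegenerate (binaryForm a b c) →
      ∀ f : ℕ, IsGreatest {k : ℕ | (k : ℤ) ^ 2 ∣ a ∧ (k : ℤ) ^ 2 ∣ b ∧ (k : ℤ) ^ 2 ∣ c} f →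
        Finite (EmbeddingClasses (binaryForm a b c) Q) ∧
        (Nat.card (EmbeddingClasses (binaryForm a b c) Q) : ℝ) ≤
          C * f * ((max |a| (max |b| |c|) : ℤ) : ℝ) ^ ε := by
  obtain ⟨K, hK1, hK⟩ := exists_card_divisors_le_rpow (δ := ε / 8) (by positivity)
  have hΔ := gramDet_ne_zero hQ
  have hΔ' : 0 < (gramDet Q).natAbs := Int.natAbs_pos.2 hΔ
  have hK0 : 0 < K := one_pos.trans_le hK1
  refine ⟨32 * ((gramDet Q).natAbs : ℝ) ^ 6 * (K * (5 : ℝ) ^ (ε / 8)) ^ 4, by positivity,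
    fun a b c hq f hf => ?_⟩
  have hD : b ^ 2 - 4 * a * c ≠ 0 := by
    have := gramDet_ne_zero hq
    rw [gramDet_binaryForm] at this
    intro h; exact this (by linear_combination -h)
  obtain ⟨hfin, hcard⟩ := card_embeddingClasses_le hD hΔ (f := f)
    fun k h1 h2 h3 => hf.2 ⟨h1, h2, h3⟩
  refine ⟨hfin, ?_⟩
  set N := (b ^ 2 - 4 * a * c).natAbs with hN
  set M := max |a| (max |b| |c|) with hM
  have hM0 : (0 : ℝ) ≤ (M : ℝ) := by
    exact_mod_cast (abs_nonneg a).trans (le_max_left _ _)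
  have hNM : (N : ℝ) ≤ 5 * (M : ℝ) ^ 2 := by
    have h : ((N : ℤ) : ℝ) ≤ ((5 * M ^ 2 : ℤ) : ℝ) := Int.cast_le.2 (natAbs_discrim_le a b c)
    rw [Int.cast_natCast, Int.cast_mul, Int.cast_pow] at h
    exact_mod_cast h
  have hd : (N.divisors.card : ℝ) ≤ K * (5 : ℝ) ^ (ε / 8) * (M : ℝ) ^ (ε / 4) := by
    calc (N.divisors.card : ℝ) ≤ K * (N : ℝ) ^ (ε / 8) := hK N (Int.natAbs_ne_zero.2 hD)
      _ ≤ K * (5 * (M : ℝ) ^ 2) ^ (ε / 8) := by gcongr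
      _ = K * (5 : ℝ) ^ (ε / 8) * (M : ℝ) ^ (ε / 4) := by
        rw [Real.mul_rpow (by norm_num) (by positivity), ← Real.rpow_natCast (M : ℝ) 2,
          ← Real.rpow_mul hM0, mul_assoc]
        congr 3
        push_cast; ring
  have hpow : ((M : ℝ) ^ (ε / 4)) ^ 4 = (M : ℝ) ^ ε := by
    rw [← Real.rpow_natCast, ← Real.rpow_mul hM0]
    congr 1
    push_cast; ring
  calc (Nat.card (EmbeddingClasses (binaryForm a b c) Q) : ℝ)
      ≤ 32 * ((gramDet Q).natAbs : ℝ) ^ 6 * f * (N.divisors.card : ℝ) ^ 4 := by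
        exact_mod_cast hcard
    _ ≤ 32 * ((gramDet Q).natAbs : ℝ) ^ 6 * f *
          (K * (5 : ℝ) ^ (ε / 8) * (M : ℝ) ^ (ε / 4)) ^ 4 := by gcongr
    _ = _ := by rw [mul_pow _ ((M : ℝ) ^ (ε / 4)), hpow]; ring
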